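/- **Setting.** Let $\tau$ be a finite relational vocabulary and let $\underline\tau=\tau\,\dot\cup\,\{P\}$ with $P$ a new unary predicate. For $\tau$-structures $\mathfrak A_1,\mathfrak A_2$ the *annotated disjoint union* $\mathfrak A_1\,\underline{\dot\cup}\,\mathfrak A_2$ is the $\underline\tau$-structure on the disjoint union of the two universes in which every predicate of $\tau$ is interpreted as the union of its two interpretations and $P$ as the universe of $\mathfrak A_1$. For a cardinal $\kappa\ge\omega$ and an ordinal $\lambda$ define classes of infinitary formulas in negation normal form, with finitely many free variables, by simultaneous induction on $\lambda$. Both $\widetilde\Sigma_{\kappa,0}$ and $\widetilde\Pi_{\kappa,0}$ are the class of quantifier-free first-order formulas in negation normal form ($\mathsf{True}$ and $\mathsf{False}$ included). For $\lambda>0$: $\widetilde\Sigma_{\kappa,\lambda,0}$ consists of the conjunctions $\bigwedge_{i\in I}\gamma_i$ with $|I|<\kappa$ and each $\gamma_i\in\widetilde\Pi_{\kappa,\lambda_i}$ for some $\lambda_i<\lambda$; $\widetilde\Sigma_{\kappa,\lambda,r+1}$ consists of the formulas of $\widetilde\Sigma_{\kappa,\lambda,r}$ and the formulas $\exists y\,\varphi_1$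 with $\varphi_1\in\widetilde\Sigma_{\kappa,\lambda,r}$; and $\widetilde\Sigma_{\kappa,\lambda}=\bigcup_{r\in\mathbb N}\widetilde\Sigma_{\kappa,\lambda,r}$. Dually, $\widetilde\Pi_{\kappa,\lambda,0}$ consists of the disjunctions $\bigvee_{i\in I}\gamma_i$ with $|I|<\kappa$ and each $\gamma_i\in\widetilde\Sigma_{\kappa,\lambda_i}$ for some $\lambda_i<\lambda$, then one closes under $\forall$. For a cardinal $\mu$, $[\mu]$ denotes the restriction to formulas of rank at most $\mu$, where the rank is the supremum of the number of quantifiers on a branch of the parse tree. Let $\mathsf{tower}(0,\kappa)=\kappa$, $\mathsf{tower}(\lambda+1,\kappa)=2^{\mathsf{tower}(\lambda,\kappa)}$, and $\mathsf{tower}(\lambda,\kappa)=2^{\sup_{\lambda'<\lambda}\mathsf{tower}(\lambda',\kappa)}$ for limit $\lambda$. Let $\rho(\kappa,\lambda)=\mathsf{tower}(\lambda,\kappa)$ if $\kappa>\omega$, and $\rho(\omega,\lambda)=\omega$. Put $\hat\rho(\widetilde\Sigma_{\kappa,\lambda}[\mu])=\widetilde\Sigma_{\rho(\kappa,\lambda),\lambda}[\mu]$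 and $\hat\rho(\widetilde\Pi_{\kappa,\lambda}[\mu])=\widetilde\Pi_{\rho(\kappa,\lambda),\lambda}[\mu]$. An *$\mathcal L$ reduction sequence over $\tau$* is a triple $D(\bar x_1,\bar x_2)=(\Delta_1(\bar x_1),\Delta_2(\bar x_2),\beta)$, where $\Delta_j=(\psi_{i,j}(\bar x_j))_{i\in I}$ is a family of $\mathcal L$ formulas over $\tau$ for $j=1,2$, and $\beta$ is a negation-free propositional formula, built with conjunctions and disjunctions of arbitrary arity, over the propositional variables $X_{i,j}$ ($i\in I$, $j\in\{1,2\}$). Write $(\mathfrak A_1,\mathfrak A_2,\bar a_1,\bar a_2)\models D$ if some truth assignment $\zeta$ satisfies $\beta$ and has $\zeta(X_{i,j})=1$ iff $(\mathfrak A_j,\bar a_j)\models\psi_{i,j}$, for all $i,j$. $D$ is a *Feferman–Vaught decomposition* of a formula $\varphi(\bar x_1,\bar x_2)$ over $\underline\tau$ (over the annotated disjoint union) if for all $\tau$-structures $\mathfrak A_1,\mathfrak A_2$ and all tuples $\bar a_j$ from $\mathfrak A_j$ with $|\bar a_j|=|\bar x_j|$, $$(\mathfrak A_1\,\underline{\dot\cup}\,\mathfrak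 A_2,\bar a_1,\bar a_2)\models\varphi\iff(\mathfrak A_1,\mathfrak A_2,\bar a_1,\bar a_2)\models D.$$ **Theorem.** Let $\kappa\ge\omega$ and $\mu\ge0$ be cardinals, $\lambda\ge0$ an ordinal, and let $\mathcal L$ be $\widetilde\Sigma_{\kappa,\lambda}[\mu]$ or $\widetilde\Pi_{\kappa,\lambda}[\mu]$. Then every $\mathcal L$ formula $\varphi(\bar x_1,\bar x_2)$ over $\underline\tau$ has a Feferman–Vaught decomposition over the annotated disjoint union which is a $\hat\rho(\mathcal L)$ reduction sequence over $\tau$. If moreover $\lambda>0$, the decomposition can be chosen so that $\beta$ is a disjunction $\bigvee_{k\in K}(X_{s(k),1}\wedge X_{t(k),2})$ when $\mathcal L=\widetilde\Sigma_{\kappa,\lambda}[\mu]$, and a conjunction $\bigwedge_{k\in K}(X_{s(k),1}\vee X_{t(k),2})$ when $\mathcal L=\widetilde\Pi_{\kappa,\lambda}[\mu]$, with $|K|\le\rho(\kappa,\lambda)$, and $K$ finite if $\kappa=\omega$. -/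

import Mathlib

open Cardinal

universe u w a b

namespace TreePrefix

/-! ### Infinitary formulas in negation normal form -/

/-- Formulas of `L_{∞,ω}` in negation normal form over the relation symbols of `L`, with free
variables among `x_0, …, x_{n-1}`. Atomic formulas and their negations are the leaves; `conj` and
`disj` take an arbitrary (small) index type; `ex φ` and `all φ` bind the last variable of `φ`.
Every formula has only finitely many free variables. (Only relation symbols are used: the
languages considered are relational, so that the only terms are the variables.) -/
inductive InfFormula (L : FirstOrder.Language.{a, b}) : ℕ → Type (max (u + 1) b)
  | rel {n k : ℕ} (R : L.Relations k) (v : Fin k → Fin n) : InfFormula L n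
  | nrel {n k : ℕ} (R : L.Relations k) (v : Fin k → Fin n) : InfFormula L n
  | eq {n : ℕ} (i j : Fin n) : InfFormula L n
  | neq {n : ℕ} (i j : Fin n) : InfFormula L n
  | conj {n : ℕ} (ι : Type u) (φ : ι → InfFormula L n) : InfFormula L n
  | disj {n : ℕ} (ι : Type u) (φ : ι → InfFormula L n) : InfFormula L n
  | ex {n : ℕ} (φ : InfFormula L (n + 1)) : InfFormula L n
  | all {n : ℕ} (φ : InfFormula L (n + 1)) : InfFormula L n

namespace InfFormula

variable {L : FirstOrder.Language.{a, b}}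

/-- Satisfaction of a formula in an `L`-structure `M` at the tuple `x`. -/
def Realize {M : Type w} [L.Structure M] : {n : ℕ} → InfFormula.{u} L n → (Fin n → M) → Prop
  | _, rel R v, x => FirstOrder.Language.Structure.RelMap R (fun i => x (v i))
  | _, nrel R v, x => ¬ FirstOrder.Language.Structure.RelMap R (fun i => x (v i))
  | _, eq i j, x => x i = x j
  | _, neq i j, x => x i ≠ x j
  | _, conj _ φ, x => ∀ i, (φ i).Realize x
  | _, disj _ φ, x => ∃ i, (φ i).Realize x
  | _, ex φ, x => ∃ y : M, φ.Realize (Fin.snoc x y)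
  | _, all φ, x => ∀ y : M, φ.Realize (Fin.snoc x y)

/-- The rank: the supremum of the number of quantifiers on the branches of the parse tree. -/
noncomputable def rank : {n : ℕ} → InfFormula.{u} L n → ℕ∞
  | _, rel _ _ => 0
  | _, nrel _ _ => 0
  | _, eq _ _ => 0
  | _, neq _ _ => 0
  | _, conj _ φ => ⨆ i, (φ i).rank
  | _, disj _ φ => ⨆ i, (φ i).rank
  | _, ex φ => φ.rank + 1
  | _, all φ => φ.rank + 1

/-- Quantifier-free first-order formulas in negation normal form: built from literals with finite
conjunctions and disjunctions (the empty ones being `True` and `False`). -/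
inductive IsQF : {n : ℕ} → InfFormula.{u} L n → Prop
  | rel {n k : ℕ} (R : L.Relations k) (v : Fin k → Fin n) : IsQF (rel R v)
  | nrel {n k : ℕ} (R : L.Relations k) (v : Fin k → Fin n) : IsQF (nrel R v)
  | eq {n : ℕ} (i j : Fin n) : IsQF (eq i j)
  | neq {n : ℕ} (i j : Fin n) : IsQF (neq i j)
  | conj {n : ℕ} (ι : Type u) [Finite ι] (φ : ι → InfFormula L n) (h : ∀ i, IsQF (φ i)) :
      IsQF (conj ι φ)
  | disj {n : ℕ} (ι : Type u) [Finite ι] (φ : ι → InfFormula L n) (h : ∀ i, IsQF (φ i)) :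
      IsQF (disj ι φ)

mutual

/-- `IsSigmaR κ lam r φ`: the formula `φ` belongs to `Σ̃_{κ,lam,r}`. -/
inductive IsSigmaR (κ : Cardinal.{u}) : Ordinal.{u} → ℕ → {n : ℕ} → InfFormula.{u} L n → Prop
  | base {n : ℕ} {φ : InfFormula L n} (h : IsQF φ) : IsSigmaR κ 0 0 φ
  | conj {lam : Ordinal.{u}} {n : ℕ} (hlam : 0 < lam) (ι : Type u) (hι : #ι < κ)
      (γ : ι → InfFormula L n) (lam' : ι → Ordinal.{u}) (r' : ι → ℕ) (hlt : ∀ i, lam' i < lam)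
      (h : ∀ i, IsPiR κ (lam' i) (r' i) (γ i)) : IsSigmaR κ lam 0 (conj ι γ)
  | mono {lam : Ordinal.{u}} {r n : ℕ} {φ : InfFormula L n} (h : IsSigmaR κ lam r φ) :
      IsSigmaR κ lam (r + 1) φ
  | ex {lam : Ordinal.{u}} {r n : ℕ} (hlam : 0 < lam) {φ : InfFormula L (n + 1)}
      (h : IsSigmaR κ lam r φ) : IsSigmaR κ lam (r + 1) (ex φ)

/-- `IsPiR κ lam r φ`: the formula `φ` belongs to `Π̃_{κ,lam,r}`. -/
inductive IsPiR (κ : Cardinal.{u}) : Ordinal.{u} → ℕ → {n : ℕ} → InfFormula.{u} L n → Prop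
  | base {n : ℕ} {φ : InfFormula L n} (h : IsQF φ) : IsPiR κ 0 0 φ
  | disj {lam : Ordinal.{u}} {n : ℕ} (hlam : 0 < lam) (ι : Type u) (hι : #ι < κ)
      (γ : ι → InfFormula L n) (lam' : ι → Ordinal.{u}) (r' : ι → ℕ) (hlt : ∀ i, lam' i < lam)
      (h : ∀ i, IsSigmaR κ (lam' i) (r' i) (γ i)) : IsPiR κ lam 0 (disj ι γ)
  | mono {lam : Ordinal.{u}} {r n : ℕ} {φ : InfFormula L n} (h : IsPiR κ lam r φ) :
      IsPiR κ lam (r + 1) φ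
  | all {lam : Ordinal.{u}} {r n : ℕ} (hlam : 0 < lam) {φ : InfFormula L (n + 1)}
      (h : IsPiR κ lam r φ) : IsPiR κ lam (r + 1) (all φ)

end

/-- The class `Σ̃_{κ,lam}[μ]`: formulas of `Σ̃_{κ,lam} = ⋃ r, Σ̃_{κ,lam,r}` of rank at most `μ`. -/
def IsSigma (κ : Cardinal.{u}) (lam : Ordinal.{u}) (μ : Cardinal.{u}) {n : ℕ}
    (φ : InfFormula.{u} L n) : Prop :=
  (∃ r, IsSigmaR κ lam r φ) ∧ (φ.rank : Cardinal.{u}) ≤ μ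

/-- The class `Π̃_{κ,lam}[μ]`: formulas of `Π̃_{κ,lam} = ⋃ r, Π̃_{κ,lam,r}` of rank at most `μ`. -/
def IsPi (κ : Cardinal.{u}) (lam : Ordinal.{u}) (μ : Cardinal.{u}) {n : ℕ}
    (φ : InfFormula.{u} L n) : Prop :=
  (∃ r, IsPiR κ lam r φ) ∧ (φ.rank : Cardinal.{u}) ≤ μ

end InfFormula

/-! ### The bound on the arities -/

/-- The `lam`-fold iterated exponential of `κ`: `tower 0 κ = κ`, `tower (lam + 1) κ` is
`2 ^ tower lam κ`, and `tower lam κ` is `2 ^ sup_{o < lam} tower o κ` for a limit `lam`. -/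
noncomputable def tower (lam : Ordinal.{u}) (κ : Cardinal.{u}) : Cardinal.{u} :=
  Ordinal.limitRecOn lam κ (fun _ c => 2 ^ c) (fun o _ c => 2 ^ ⨆ p : Set.Iio o, c p.1 p.2)

open scoped Classical in
/-- `ρ(κ, lam)` is `tower lam κ` for uncountable `κ`, and `ω` otherwise. -/
noncomputable def rho (κ : Cardinal.{u}) (lam : Ordinal.{u}) : Cardinal.{u} :=
  if ℵ₀ < κ then tower lam κ else ℵ₀

/-! ### Annotated disjoint unions -/

/-- The vocabulary whose only symbol is one unary predicate `P`. -/
def markLanguage : FirstOrder.Language.{0, 0} := ⟨fun _ => Empty, fun k => {_u : Unit // k = 1}⟩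

/-- The vocabulary `τ ∪ {P}`, where `P` is a new unary predicate. -/
abbrev annotated (L : FirstOrder.Language.{a, b}) : FirstOrder.Language.{a, b} := L.sum markLanguage

/-- The annotated disjoint union of the structures `A₁` and `A₂`, with universe `A₁ ⊕ A₂`: every
symbol of `L` is interpreted as the union of its interpretations in the two copies, and `P` as the
copy of `A₁`. -/
@[reducible] def annotatedUnion (L : FirstOrder.Language.{a, b}) [L.IsRelational] (A₁ A₂ : Type w)
    [L.Structure A₁] [L.Structure A₂] : (annotated L).Structure (A₁ ⊕ A₂) where
  funMap f _ := match f with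
    | .inl f => isEmptyElim f
    | .inr f => Empty.elim f
  RelMap R x := match R with
    | .inl R => (∃ y, x = Sum.inl ∘ y ∧ FirstOrder.Language.Structure.RelMap (M := A₁) R y) ∨
        (∃ y, x = Sum.inr ∘ y ∧ FirstOrder.Language.Structure.RelMap (M := A₂) R y)
    | .inr _ => ∀ i, (x i).isLeft

/-! ### Reduction sequences -/

/-- Infinitary propositional formulas without negation over the propositional variables `V`. -/
inductive PropFormula (V : Type u) : Type (u + 1)
  | var (X : V) : PropFormula V
  | conj (ι : Type u) (β : ι → PropFormula V) : PropFormula V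
  | disj (ι : Type u) (β : ι → PropFormula V) : PropFormula V

namespace PropFormula

variable {V : Type u}

/-- The assignment `ζ` satisfies the propositional formula. -/
def Holds (ζ : V → Bool) : PropFormula V → Prop
  | var X => ζ X = true
  | conj _ β => ∀ i, (β i).Holds ζ
  | disj _ β => ∃ i, (β i).Holds ζ

/-- The conjunction of two formulas. -/
def and (p q : PropFormula V) : PropFormula V := conj (ULift Bool) fun c => cond c.down p q

/-- The disjunction of two formulas. -/
def or (p q : PropFormula V) : PropFormula V := disj (ULift Bool) fun c => cond c.down p q

end PropFormula

/-- A reduction sequence `(Δ₁(x̄₁), Δ₂(x̄₂), β)` over `L`, with `|x̄₁| = m₁` and `|x̄₂| = m₂`: two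
families of formulas with the same index set `I`, and an infinitary propositional formula over the
variables `X_{i,1}` (written `Sum.inl i`) and `X_{i,2}` (written `Sum.inr i`), `i : I`. -/
structure ReductionSequence (L : FirstOrder.Language.{a, b}) (m₁ m₂ : ℕ) where
  I : Type u
  Δ₁ : I → InfFormula.{u} L m₁
  Δ₂ : I → InfFormula.{u} L m₂
  β : PropFormula (I ⊕ I)

namespace ReductionSequence

variable {L : FirstOrder.Language.{a, b}} {m₁ m₂ : ℕ}

/-- All formulas of the reduction sequence belong to the logic `Λ`. -/
def IsOver (D : ReductionSequence.{u} L m₁ m₂) (Λ : ∀ {n : ℕ}, InfFormula.{u} L n → Prop) : Prop :=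
  ∀ i, Λ (D.Δ₁ i) ∧ Λ (D.Δ₂ i)

/-- `(A₁, A₂, a₁, a₂)` is a model of the reduction sequence. -/
def Models (D : ReductionSequence.{u} L m₁ m₂) {A₁ A₂ : Type w} [L.Structure A₁] [L.Structure A₂]
    (a₁ : Fin m₁ → A₁) (a₂ : Fin m₂ → A₂) : Prop :=
  ∃ ζ : D.I ⊕ D.I → Bool, D.β.Holds ζ ∧
    ∀ i, (ζ (.inl i) = true ↔ (D.Δ₁ i).Realize a₁) ∧ (ζ (.inr i) = true ↔ (D.Δ₂ i).Realize a₂)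

/-- `D` is a Feferman–Vaught decomposition of `φ(x̄₁, x̄₂)` over the annotated disjoint union; the
first `m₁` variables of `φ` form `x̄₁` and the last `m₂` form `x̄₂`. -/
def IsFVDecomposition [L.IsRelational] (D : ReductionSequence.{u} L m₁ m₂)
    (φ : InfFormula.{u} (annotated L) (m₁ + m₂)) : Prop :=
  ∀ (A₁ A₂ : Type w) [L.Structure A₁] [L.Structure A₂] (a₁ : Fin m₁ → A₁) (a₂ : Fin m₂ → A₂),
    letI := annotatedUnion L A₁ A₂
    φ.Realize (Fin.append (Sum.inl ∘ a₁ : Fin m₁ → A₁ ⊕ A₂) (Sum.inr ∘ a₂)) ↔ D.Models a₁ a₂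

/-- The size of an index set of the combining formula: at most `ρ(κ, lam)`, and finite for
`κ = ω`. -/
def SmallIndex (κ : Cardinal.{u}) (lam : Ordinal.{u}) (K : Type u) : Prop :=
  #K ≤ rho κ lam ∧ (κ = ℵ₀ → Finite K)

/-- The combining formula is a disjunction `⋁_{k ∈ K} (X_{s k, 1} ∧ X_{t k, 2})` with a small
index set `K`. -/
def IsDNF (D : ReductionSequence.{u} L m₁ m₂) (κ : Cardinal.{u}) (lam : Ordinal.{u}) : Prop :=
  ∃ (K : Type u) (s t : K → D.I), SmallIndex κ lam K ∧
    D.β = .disj K fun k => .and (.var (.inl (s k))) (.var (.inr (t k)))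

/-- The combining formula is a conjunction `⋀_{k ∈ K} (X_{s k, 1} ∨ X_{t k, 2})` with a small
index set `K`. -/
def IsCNF (D : ReductionSequence.{u} L m₁ m₂) (κ : Cardinal.{u}) (lam : Ordinal.{u}) : Prop :=
  ∃ (K : Type u) (s t : K → D.I), SmallIndex κ lam K ∧
    D.β = .conj K fun k => .or (.var (.inl (s k))) (.var (.inr (t k)))

end ReductionSequence

end TreePrefix

namespace TreePrefix

/-! ### Iterated exponentials -/

-- By negation only the Σ̃ case matters. The invariant is that, for every placement of the variables
-- in the two components, a Σ̃ formula is equivalent over annotated disjoint unions to a disjunction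
-- of pairs `ψ₁ k ∧ ψ₂ k` of Σ̃ formulas of the same level and no larger rank
-- (`IsSigmaR.exists_splitsInto`). The proof is by induction on the level and then on the quantifier
-- prefix.
--
-- Literals split by inspection. An existential witness lies in one of the components, and the
-- quantifier distributes over the disjunction and binds one member of each pair (`SplitsInto.ex`).
-- For a conjunction of Π̃ formulas `γ i`, split each `¬ γ i`, which is Σ̃ of a lower level. If `T`
-- is the set of all pairs obtained, the conjunction says that in each pair one member fails. By
-- distributivity this is the disjunction over `S ⊆ T` of `⋀_{p ∈ S} ¬ψ₁ p ∧ ⋀_{p ∉ S} ¬ψ₂ p`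
-- (`SplitsInto.conj`). The passage from `T` to its power set costs one exponential per level, which
-- `tower` absorbs (`SmallIndex.sigma`).

theorem tower_zero (κ : Cardinal.{u}) : tower 0 κ = κ := by
  unfold tower
  exact Ordinal.limitRecOn_zero _ _ _

/-- Treats successor and limit stages alike: each is one exponential above a common bound for all
earlier stages. -/
theorem exists_tower_eq_two_power (κ : Cardinal.{u}) (lam : Ordinal.{u}) (h : 0 < lam) :
    ∃ B : Cardinal.{u}, tower lam κ = 2 ^ B ∧ ∀ o < lam, tower o κ ≤ B := by
  induction lam using Ordinal.limitRecOn with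
  | zero => exact absurd h (lt_irrefl _)
  | add_one o ih =>
    refine ⟨tower o κ, ?_, fun o' ho' => ?_⟩
    · unfold tower
      exact Ordinal.limitRecOn_add_one _ _ _ _
    · rcases (Order.lt_add_one_iff.1 ho').eq_or_lt with rfl | hlt
      · exact le_rfl
      · obtain ⟨B, hB, hle⟩ := ih (lt_of_le_of_lt (zero_le) hlt)
        exact (hle o' hlt).trans (hB ▸ (Cardinal.cantor B).le)
  | limit o ho _ =>
    refine ⟨⨆ p : Set.Iio o, tower p.1 κ, ?_, fun o' ho' => ?_⟩
    · unfold tower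
      exact Ordinal.limitRecOn_limit _ _ _ _ ho
    · exact le_ciSup (f := fun p : Set.Iio o => tower p.1 κ) (Cardinal.bddAbove_of_small)
        ⟨o', ho'⟩

theorem tower_mono (κ : Cardinal.{u}) : Monotone fun lam : Ordinal.{u} => tower lam κ := by
  intro o lam h
  rcases h.eq_or_lt with rfl | hlt
  · exact le_rfl
  · obtain ⟨B, hB, hle⟩ := exists_tower_eq_two_power κ lam (lt_of_le_of_lt (zero_le) hlt)
    exact (hle o hlt).trans ((Cardinal.cantor B).le.trans_eq hB.symm)

theorem rho_mono (κ : Cardinal.{u}) : Monotone (rho κ) := by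
  intro o lam h
  unfold rho
  split_ifs
  · exact tower_mono κ h
  · exact le_rfl

theorem aleph0_le_rho (κ : Cardinal.{u}) (lam : Ordinal.{u}) : ℵ₀ ≤ rho κ lam := by
  unfold rho
  split_ifs with h
  · exact h.le.trans ((tower_zero κ).ge.trans (tower_mono κ (zero_le)))
  · exact le_rfl

-- Sizes of the index sets

namespace ReductionSequence

theorem SmallIndex.of_finite (κ : Cardinal.{u}) (lam : Ordinal.{u}) (K : Type u) [Finite K] :
    SmallIndex κ lam K :=
  ⟨(Cardinal.lt_aleph0_of_finite K).le.trans (aleph0_le_rho κ lam), fun _ => inferInstance⟩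

theorem SmallIndex.sum {κ : Cardinal.{u}} {lam : Ordinal.{u}} {K K' : Type u}
    (h : SmallIndex κ lam K) (h' : SmallIndex κ lam K') : SmallIndex κ lam (K ⊕ K') := by
  refine ⟨?_, fun hκ => ?_⟩
  · rw [← Cardinal.add_def]
    exact Cardinal.add_le_of_le (aleph0_le_rho κ lam) h.1 h'.1
  · have := h.2 hκ
    have := h'.2 hκ
    infer_instance

/-- The size count for the conjunction step. With `rho κ lam = 2 ^ B` there are at most `κ * B = B`
pairs, hence at most `2 ^ B` sets of pairs. Cantor's theorem gives the strict inequality required of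
the arity of a conjunction. For `κ = ℵ₀` everything is finite. -/
theorem SmallIndex.sigma {κ : Cardinal.{u}} (hκ : ℵ₀ ≤ κ) {lam : Ordinal.{u}} (hlam : 0 < lam)
    {ι : Type u} (hι : #ι < κ) {o : ι → Ordinal.{u}} (ho : ∀ i, o i < lam) {K : ι → Type u}
    (hK : ∀ i, SmallIndex κ (o i) (K i)) :
    #(Σ i, K i) < rho κ lam ∧ SmallIndex κ lam (Set (Σ i, K i)) := by
  rcases hκ.eq_or_lt with rfl | hlt
  · have : Finite ι := Cardinal.lt_aleph0_iff_finite.1 hι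
    have : ∀ i, Finite (K i) := fun i => (hK i).2 rfl
    exact ⟨(Cardinal.lt_aleph0_of_finite _).trans_le (aleph0_le_rho _ _), .of_finite _ _ _⟩
  · obtain ⟨B, hB, hle⟩ := exists_tower_eq_two_power κ lam hlam
    have hκB : κ ≤ B := (tower_zero κ).ge.trans (hle 0 hlam)
    have hrho : rho κ lam = 2 ^ B := by rw [rho, if_pos hlt, hB]
    have hT : #(Σ i, K i) ≤ B := by
      rw [Cardinal.mk_sigma]
      refine (Cardinal.sum_le_sum (fun i => #(K i)) (fun _ => B) fun i => ?_).trans ?_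
      · have := (hK i).1
        rw [rho, if_pos hlt] at this
        exact this.trans (hle _ (ho i))
      · rw [Cardinal.sum_const']
        exact Cardinal.mul_le_of_le (hκ.trans hκB) (hι.le.trans hκB) le_rfl
    refine ⟨hrho ▸ hT.trans_lt (Cardinal.cantor B), ?_, fun h => absurd h hlt.ne'⟩
    rw [Cardinal.mk_set, hrho]
    exact Cardinal.power_le_power_left two_ne_zero hT

end ReductionSequence

/-! ### Negation and monotonicity of the formula classes -/

namespace InfFormula

variable {L : FirstOrder.Language.{a, b}}

/-- The negation normal form of the negation of a formula. -/
def neg : {n : ℕ} → InfFormula.{u} L n → InfFormula.{u} L n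
  | _, rel R v => nrel R v
  | _, nrel R v => rel R v
  | _, eq i j => neq i j
  | _, neq i j => eq i j
  | _, conj ι φ => disj ι fun i => (φ i).neg
  | _, disj ι φ => conj ι fun i => (φ i).neg
  | _, ex φ => all φ.neg
  | _, all φ => ex φ.neg

theorem realize_neg {M : Type w} [L.Structure M] {n : ℕ} (φ : InfFormula.{u} L n)
    (x : Fin n → M) : φ.neg.Realize x ↔ ¬ φ.Realize x := by
  induction φ <;> simp_all [neg, Realize]

theorem rank_neg {n : ℕ} (φ : InfFormula.{u} L n) : φ.neg.rank = φ.rank := by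
  induction φ <;> simp_all [neg, rank]

theorem IsQF.neg {n : ℕ} {φ : InfFormula.{u} L n} (h : IsQF φ) : IsQF φ.neg := by
  induction h with
  | rel R v => exact .nrel R v
  | nrel R v => exact .rel R v
  | eq i j => exact .neq i j
  | neq i j => exact .eq i j
  | conj ι φ _ ih => exact .disj ι _ ih
  | disj ι φ _ ih => exact .conj ι _ ih

theorem IsQF.rank_eq_zero {n : ℕ} {φ : InfFormula.{u} L n} (h : IsQF φ) : φ.rank = 0 := by
  induction h <;> simp_all [rank]

mutual

theorem IsSigmaR.neg {κ : Cardinal.{u}} {lam : Ordinal.{u}} {r n : ℕ} {φ : InfFormula.{u} L n} :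
    IsSigmaR κ lam r φ → IsPiR κ lam r φ.neg
  | .base h => .base h.neg
  | .conj hlam ι hι _ lam' r' hlt h => .disj hlam ι hι _ lam' r' hlt fun i => (h i).neg
  | .mono h => .mono h.neg
  | .ex hlam h => .all hlam h.neg

theorem IsPiR.neg {κ : Cardinal.{u}} {lam : Ordinal.{u}} {r n : ℕ} {φ : InfFormula.{u} L n} :
    IsPiR κ lam r φ → IsSigmaR κ lam r φ.neg
  | .base h => .base h.neg
  | .disj hlam ι hι _ lam' r' hlt h => .conj hlam ι hι _ lam' r' hlt fun i => (h i).neg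
  | .mono h => .mono h.neg
  | .all hlam h => .ex hlam h.neg

end

mutual

theorem IsSigmaR.mono_card {κ κ' : Cardinal.{u}} (hκ : κ ≤ κ') {lam : Ordinal.{u}} {r n : ℕ}
    {φ : InfFormula.{u} L n} : IsSigmaR κ lam r φ → IsSigmaR κ' lam r φ
  | .base h => .base h
  | .conj hlam ι hι _ lam' r' hlt h =>
    .conj hlam ι (hι.trans_le hκ) _ lam' r' hlt fun i => (h i).mono_card hκ
  | .mono h => .mono (h.mono_card hκ)
  | .ex hlam h => .ex hlam (h.mono_card hκ)

theorem IsPiR.mono_card {κ κ' : Cardinal.{u}} (hκ : κ ≤ κ') {lam : Ordinal.{u}} {r n : ℕ}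
    {φ : InfFormula.{u} L n} : IsPiR κ lam r φ → IsPiR κ' lam r φ
  | .base h => .base h
  | .disj hlam ι hι _ lam' r' hlt h =>
    .disj hlam ι (hι.trans_le hκ) _ lam' r' hlt fun i => (h i).mono_card hκ
  | .mono h => .mono (h.mono_card hκ)
  | .all hlam h => .all hlam (h.mono_card hκ)

end

/-- The true formula. -/
protected def top {n : ℕ} : InfFormula.{u} L n := conj PEmpty PEmpty.elim

/-- The false formula. -/
protected def bot {n : ℕ} : InfFormula.{u} L n := disj PEmpty PEmpty.elim

theorem realize_top {M : Type w} [L.Structure M] {n : ℕ} (x : Fin n → M) :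
    (InfFormula.top : InfFormula.{u} L n).Realize x ↔ True := by
  simp [InfFormula.top, Realize]

theorem realize_bot {M : Type w} [L.Structure M] {n : ℕ} (x : Fin n → M) :
    (InfFormula.bot : InfFormula.{u} L n).Realize x ↔ False := by
  simp [InfFormula.bot, Realize]

theorem isQF_top {n : ℕ} : IsQF (InfFormula.top : InfFormula.{u} L n) := .conj _ _ (·.elim)

theorem isQF_bot {n : ℕ} : IsQF (InfFormula.bot : InfFormula.{u} L n) := .disj _ _ (·.elim)

/-- The conjunction of the negations of the `ψ p`, `p ∈ S`. -/
def conjNeg {m : ℕ} {T : Type u} (ψ : T → InfFormula.{u} L m) (S : Set T) : InfFormula.{u} L m :=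
  .conj S fun p => (ψ p).neg

theorem rank_conjNeg_le {m : ℕ} {T : Type u} {ψ : T → InfFormula.{u} L m} {S : Set T} {c : ℕ∞}
    (h : ∀ p, (ψ p).rank ≤ c) : (conjNeg ψ S).rank ≤ c := by
  simp only [conjNeg, rank, rank_neg]
  exact iSup_le fun p => h p

/-- Negations of Σ̃ formulas of lower level are Π̃ of that level, so they are admissible conjuncts,
and a subset of `T` is no larger than `T`. -/
theorem isSigmaR_conjNeg {κ : Cardinal.{u}} {lam : Ordinal.{u}} (hlam : 0 < lam) {m : ℕ}
    {T : Type u} (hT : #T < κ) {ψ : T → InfFormula.{u} L m} {o : T → Ordinal.{u}}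
    (ho : ∀ p, o p < lam) (h : ∀ p, ∃ r, IsSigmaR κ (o p) r (ψ p)) (S : Set T) :
    IsSigmaR κ lam 0 (conjNeg ψ S) := by
  choose r hr using h
  exact .conj hlam S ((Cardinal.mk_set_le S).trans_lt hT) _ (fun p => o p) (fun p => r p)
    (fun p => ho p) fun p => (hr p).neg

/-- The first-component formula expressing that all arguments of `R` lie in the first component
and satisfy `R` there. -/
theorem exists_isQF_relMap_inl {k m₁ m₂ : ℕ} (R : L.Relations k) (τ : Fin k → Fin m₁ ⊕ Fin m₂) :
    ∃ ψ : InfFormula.{u} L m₁, IsQF ψ ∧ ∀ (A₁ A₂ : Type w) [L.Structure A₁]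
      (a₁ : Fin m₁ → A₁) (a₂ : Fin m₂ → A₂), ψ.Realize a₁ ↔
        ∃ y, Sum.map a₁ a₂ ∘ τ = Sum.inl ∘ y ∧ FirstOrder.Language.Structure.RelMap R y := by
  -- Whether all arguments lie in the first component depends on `τ` alone; if they do not, the
  -- formula is `False`.
  by_cases h : ∃ v, τ = Sum.inl ∘ v
  · obtain ⟨v, rfl⟩ := h
    refine ⟨.rel R v, .rel R v, fun A₁ A₂ _ a₁ a₂ => ⟨fun h => ⟨_, rfl, h⟩, ?_⟩⟩
    rintro ⟨y, hy, h⟩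
    have : y = fun i => a₁ (v i) := funext fun i => (Sum.inl.inj (congrFun hy i)).symm
    rwa [this] at h
  · refine ⟨.bot, isQF_bot, fun A₁ A₂ _ a₁ a₂ => ?_⟩
    rw [realize_bot, false_iff]
    rintro ⟨y, hy, -⟩
    have : ∀ i, ∃ j, τ i = Sum.inl j := by
      intro i
      have := congrFun hy i
      rcases hi : τ i with j | j
      · exact ⟨j, rfl⟩
      · simp [hi] at this
    choose v hv using this
    exact h ⟨v, funext hv⟩

/-- The second-component formula expressing that all arguments of `R` lie in the second component
and satisfy `R` there. -/
theorem exists_isQF_relMap_inr {k m₁ m₂ : ℕ} (R : L.Relations k) (τ : Fin k → Fin m₁ ⊕ Fin m₂) :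
    ∃ ψ : InfFormula.{u} L m₂, IsQF ψ ∧ ∀ (A₁ A₂ : Type w) [L.Structure A₂]
      (a₁ : Fin m₁ → A₁) (a₂ : Fin m₂ → A₂), ψ.Realize a₂ ↔
        ∃ y, Sum.map a₁ a₂ ∘ τ = Sum.inr ∘ y ∧ FirstOrder.Language.Structure.RelMap R y := by
  obtain ⟨ψ, hψ, h⟩ := exists_isQF_relMap_inl.{u, w} R (Sum.swap ∘ τ)
  refine ⟨ψ, hψ, fun A₁ A₂ _ a₁ a₂ => (h A₂ A₁ a₂ a₁).trans (exists_congr fun y => ?_)⟩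
  refine and_congr_left fun _ => ?_
  simp only [funext_iff, Function.comp_apply]
  refine forall_congr' fun i => ?_
  rcases τ i with j | j <;> simp

/-! ### Splitting a formula over the two components -/

/-- With the `i`-th variable of `φ` placed in the component and position `σ i`, the formula `φ` is
equivalent over annotated disjoint unions to the disjunction of the `ψ₁ k ∧ ψ₂ k`. -/
def SplitsInto [L.IsRelational] {n m₁ m₂ : ℕ} (φ : InfFormula.{u} (annotated L) n)
    (σ : Fin n → Fin m₁ ⊕ Fin m₂) {K : Type u} (ψ₁ : K → InfFormula.{u} L m₁)
    (ψ₂ : K → InfFormula.{u} L m₂) : Prop :=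
  ∀ (A₁ A₂ : Type w) [L.Structure A₁] [L.Structure A₂] (a₁ : Fin m₁ → A₁) (a₂ : Fin m₂ → A₂),
    letI := annotatedUnion L A₁ A₂
    φ.Realize (Sum.map a₁ a₂ ∘ σ) ↔ ∃ k, (ψ₁ k).Realize a₁ ∧ (ψ₂ k).Realize a₂

variable [L.IsRelational]

/-- `φ` splits over `σ` into finitely many pairs of quantifier-free formulas. -/
def HasQFSplit {n m₁ m₂ : ℕ} (φ : InfFormula.{u} (annotated L) n)
    (σ : Fin n → Fin m₁ ⊕ Fin m₂) : Prop :=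
  ∃ (K : Type u) (_ : Finite K) (ψ₁ : K → InfFormula.{u} L m₁) (ψ₂ : K → InfFormula.{u} L m₂),
    (∀ k, IsQF (ψ₁ k)) ∧ (∀ k, IsQF (ψ₂ k)) ∧ SplitsInto.{u, w} φ σ ψ₁ ψ₂

variable {n m₁ m₂ : ℕ} {σ : Fin n → Fin m₁ ⊕ Fin m₂}

theorem HasQFSplit.of_pair {φ : InfFormula.{u} (annotated L) n} (ψ₁ : InfFormula.{u} L m₁)
    (ψ₂ : InfFormula.{u} L m₂) (h₁ : IsQF ψ₁) (h₂ : IsQF ψ₂)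
    (h : SplitsInto.{u, w} φ σ (fun _ : PUnit => ψ₁) fun _ => ψ₂) : HasQFSplit.{u, w} φ σ :=
  ⟨PUnit, inferInstance, _, _, fun _ => h₁, fun _ => h₂, h⟩

/-- Distributivity: a disjunct of the conjunction chooses one pair for each `i`, and a finite
product of finite sets is finite. -/
theorem HasQFSplit.conj {ι : Type u} [Finite ι] {φ : ι → InfFormula.{u} (annotated L) n}
    (h : ∀ i, HasQFSplit.{u, w} (φ i) σ) : HasQFSplit.{u, w} (conj ι φ) σ := by
  choose K hK ψ₁ ψ₂ h₁ h₂ h using h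
  refine ⟨∀ i, K i, inferInstance, fun f => .conj ι fun i => ψ₁ i (f i),
    fun f => .conj ι fun i => ψ₂ i (f i), fun f => .conj _ _ fun i => h₁ _ _,
    fun f => .conj _ _ fun i => h₂ _ _, fun A₁ A₂ _ _ a₁ a₂ => ?_⟩
  simp only [Realize, h _ A₁ A₂ a₁ a₂, Classical.skolem, forall_and]

theorem HasQFSplit.disj {ι : Type u} [Finite ι] {φ : ι → InfFormula.{u} (annotated L) n}
    (h : ∀ i, HasQFSplit.{u, w} (φ i) σ) : HasQFSplit.{u, w} (disj ι φ) σ := by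
  choose K hK ψ₁ ψ₂ h₁ h₂ h using h
  refine ⟨Σ i, K i, inferInstance, fun p => ψ₁ p.1 p.2, fun p => ψ₂ p.1 p.2,
    fun p => h₁ _ _, fun p => h₂ _ _, fun A₁ A₂ _ _ a₁ a₂ => ?_⟩
  simp only [Realize, h _ A₁ A₂ a₁ a₂, Sigma.exists]

/-- A symbol of `L` holds only of tuples inside one component, which gives two pairs, each with a
trivial partner. -/
theorem hasQFSplit_rel {k : ℕ} (R : (annotated L).Relations k) (v : Fin k → Fin n) :
    HasQFSplit.{u, w} (rel R v) σ := by
  rcases R with R | R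
  · obtain ⟨ψ₁, hψ₁, h₁⟩ := exists_isQF_relMap_inl.{u, w} R (σ ∘ v)
    obtain ⟨ψ₂, hψ₂, h₂⟩ := exists_isQF_relMap_inr.{u, w} R (σ ∘ v)
    refine ⟨ULift Bool, inferInstance, fun c => cond c.down ψ₁ .top,
      fun c => cond c.down .top ψ₂, ?_, ?_, fun A₁ A₂ _ _ a₁ a₂ => ?_⟩
    · rintro ⟨_ | _⟩
      exacts [isQF_top, hψ₁]
    · rintro ⟨_ | _⟩
      exacts [hψ₂, isQF_top]
    · simp only [ULift.exists, Bool.exists_bool, cond_true, cond_false, realize_top, true_and,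
        and_true]
      rw [h₁ A₁ A₂ a₁ a₂, h₂ A₁ A₂ a₁ a₂, or_comm]
      rfl
  -- The truth value of `P` is fixed by the placement.
  · by_cases h : ∀ i, (σ (v i)).isLeft
    · refine .of_pair .top .top isQF_top isQF_top fun A₁ A₂ _ _ a₁ a₂ => ?_
      simp only [realize_top, exists_const, and_self, iff_true]
      change ∀ i, (Sum.map a₁ a₂ (σ (v i))).isLeft
      simpa using h
    · refine .of_pair .bot .bot isQF_bot isQF_bot fun A₁ A₂ _ _ a₁ a₂ => ?_
      simp only [realize_bot, exists_const, and_self, iff_false]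
      change ¬ ∀ i, (Sum.map a₁ a₂ (σ (v i))).isLeft
      simpa using h

/-- Negating the two-pair disjunction for a symbol of `L` leaves a single pair, since the partners
were trivial. -/
theorem hasQFSplit_nrel {k : ℕ} (R : (annotated L).Relations k) (v : Fin k → Fin n) :
    HasQFSplit.{u, w} (nrel R v) σ := by
  rcases R with R | R
  · obtain ⟨ψ₁, hψ₁, h₁⟩ := exists_isQF_relMap_inl.{u, w} R (σ ∘ v)
    obtain ⟨ψ₂, hψ₂, h₂⟩ := exists_isQF_relMap_inr.{u, w} R (σ ∘ v)
    refine .of_pair ψ₁.neg ψ₂.neg hψ₁.neg hψ₂.neg fun A₁ A₂ _ _ a₁ a₂ => ?_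
    simp only [exists_const, realize_neg]
    rw [h₁ A₁ A₂ a₁ a₂, h₂ A₁ A₂ a₁ a₂, ← not_or]
    rfl
  · by_cases h : ∀ i, (σ (v i)).isLeft
    · refine .of_pair .bot .bot isQF_bot isQF_bot fun A₁ A₂ _ _ a₁ a₂ => ?_
      simp only [realize_bot, exists_const, and_self, iff_false]
      change ¬ ¬ ∀ i, (Sum.map a₁ a₂ (σ (v i))).isLeft
      simpa using h
    · refine .of_pair .top .top isQF_top isQF_top fun A₁ A₂ _ _ a₁ a₂ => ?_
      simp only [realize_top, exists_const, and_self, iff_true]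
      change ¬ ∀ i, (Sum.map a₁ a₂ (σ (v i))).isLeft
      simpa using h

theorem hasQFSplit_eq (i j : Fin n) :
    HasQFSplit.{u, w} (eq i j : InfFormula.{u} (annotated L) n) σ := by
  rcases hi : σ i with i' | i' <;> rcases hj : σ j with j' | j'
  · exact .of_pair (.eq i' j') .top (.eq _ _) isQF_top fun A₁ A₂ _ _ a₁ a₂ => by
      simp [Realize, realize_top, hi, hj]
  · exact .of_pair .bot .bot isQF_bot isQF_bot fun A₁ A₂ _ _ a₁ a₂ => by
      simp [Realize, realize_bot, hi, hj]
  · exact .of_pair .bot .bot isQF_bot isQF_bot fun A₁ A₂ _ _ a₁ a₂ => by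
      simp [Realize, realize_bot, hi, hj]
  · exact .of_pair .top (.eq i' j') isQF_top (.eq _ _) fun A₁ A₂ _ _ a₁ a₂ => by
      simp [Realize, realize_top, hi, hj]

theorem hasQFSplit_neq (i j : Fin n) :
    HasQFSplit.{u, w} (neq i j : InfFormula.{u} (annotated L) n) σ := by
  rcases hi : σ i with i' | i' <;> rcases hj : σ j with j' | j'
  · exact .of_pair (.neq i' j') .top (.neq _ _) isQF_top fun A₁ A₂ _ _ a₁ a₂ => by
      simp [Realize, realize_top, hi, hj]
  · exact .of_pair .top .top isQF_top isQF_top fun A₁ A₂ _ _ a₁ a₂ => by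
      simp [Realize, realize_top, hi, hj]
  · exact .of_pair .top .top isQF_top isQF_top fun A₁ A₂ _ _ a₁ a₂ => by
      simp [Realize, realize_top, hi, hj]
  · exact .of_pair .top (.neq i' j') isQF_top (.neq _ _) fun A₁ A₂ _ _ a₁ a₂ => by
      simp [Realize, realize_top, hi, hj]

theorem IsQF.hasQFSplit {φ : InfFormula.{u} (annotated L) n} (h : IsQF φ)
    (σ : Fin n → Fin m₁ ⊕ Fin m₂) : HasQFSplit.{u, w} φ σ := by
  induction h with
  | rel R v => exact hasQFSplit_rel R v
  | nrel R v => exact hasQFSplit_nrel R v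
  | eq i j => exact hasQFSplit_eq i j
  | neq i j => exact hasQFSplit_neq i j
  | conj ι φ _ ih => exact .conj fun i => ih i
  | disj ι φ _ ih => exact .disj fun i => ih i

/-! ### The existential quantifier and the infinitary conjunction -/

/-- The two hypotheses place the bound variable last in the first or in the second component. The
member of a pair about the other component does not mention the witness, so the quantifier passes
over it. -/
theorem SplitsInto.ex {φ : InfFormula.{u} (annotated L) (n + 1)} {K K' : Type u}
    {ψ₁ : K → InfFormula.{u} L (m₁ + 1)} {ψ₂ : K → InfFormula.{u} L m₂}
    {χ₁ : K' → InfFormula.{u} L m₁} {χ₂ : K' → InfFormula.{u} L (m₂ + 1)}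
    (h : SplitsInto.{u, w} φ
      (Fin.snoc (α := fun _ => Fin (m₁ + 1) ⊕ Fin m₂) (Sum.map Fin.castSucc id ∘ σ)
        (.inl (Fin.last m₁))) ψ₁ ψ₂)
    (h' : SplitsInto.{u, w} φ
      (Fin.snoc (α := fun _ => Fin m₁ ⊕ Fin (m₂ + 1)) (Sum.map id Fin.castSucc ∘ σ)
        (.inr (Fin.last m₂))) χ₁ χ₂) :
    SplitsInto.{u, w} φ.ex σ (Sum.elim (fun k => (ψ₁ k).ex) χ₁)
      (Sum.elim ψ₂ fun k => (χ₂ k).ex) := by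
  intro A₁ A₂ _ _ a₁ a₂
  have e₁ (y : A₁) : (Fin.snoc (α := fun _ => A₁ ⊕ A₂) (Sum.map a₁ a₂ ∘ σ) (.inl y)) =
      Sum.map (Fin.snoc (α := fun _ => A₁) a₁ y) a₂ ∘
        (Fin.snoc (α := fun _ => Fin (m₁ + 1) ⊕ Fin m₂) (Sum.map Fin.castSucc id ∘ σ)
          (.inl (Fin.last m₁))) := by
    funext i
    refine Fin.lastCases ?_ (fun i => ?_) i
    · simp
    · rcases hi : σ i with j | j <;> simp [hi]
  have e₂ (y : A₂) : (Fin.snoc (α := fun _ => A₁ ⊕ A₂) (Sum.map a₁ a₂ ∘ σ) (.inr y)) =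
      Sum.map a₁ (Fin.snoc (α := fun _ => A₂) a₂ y) ∘
        (Fin.snoc (α := fun _ => Fin m₁ ⊕ Fin (m₂ + 1)) (Sum.map id Fin.castSucc ∘ σ)
          (.inr (Fin.last m₂))) := by
    funext i
    refine Fin.lastCases ?_ (fun i => ?_) i
    · simp
    · rcases hi : σ i with j | j <;> simp [hi]
  simp only [Realize, Sum.exists, Sum.elim_inl, Sum.elim_inr]
  refine or_congr ?_ ?_
  · simp only [e₁, h A₁ A₂ _ a₂]
    exact ⟨fun ⟨y, k, h₁, h₂⟩ => ⟨k, ⟨y, h₁⟩, h₂⟩, fun ⟨k, ⟨y, h₁⟩, h₂⟩ => ⟨y, k, h₁, h₂⟩⟩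
  · simp only [e₂, h' A₁ A₂ a₁ _]
    exact ⟨fun ⟨y, k, h₁, h₂⟩ => ⟨k, h₁, y, h₂⟩, fun ⟨k, h₁, y, h₂⟩ => ⟨y, k, h₁, h₂⟩⟩

theorem SplitsInto.conj {ι : Type u} {γ : ι → InfFormula.{u} (annotated L) n} {K : ι → Type u}
    {ψ₁ : ∀ i, K i → InfFormula.{u} L m₁} {ψ₂ : ∀ i, K i → InfFormula.{u} L m₂}
    (h : ∀ i, SplitsInto.{u, w} (γ i).neg σ (ψ₁ i) (ψ₂ i)) :
    SplitsInto.{u, w} (conj ι γ) σ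
      (fun S : Set (Σ i, K i) => conjNeg (fun p : Σ i, K i => ψ₁ p.1 p.2) S)
      fun S => conjNeg (fun p : Σ i, K i => ψ₂ p.1 p.2) Sᶜ := by
  intro A₁ A₂ _ _ a₁ a₂
  let := annotatedUnion L A₁ A₂
  have key (i : ι) : (γ i).Realize (Sum.map a₁ a₂ ∘ σ) ↔
      ∀ k, ¬ ((ψ₁ i k).Realize a₁ ∧ (ψ₂ i k).Realize a₂) := by
    rw [← not_exists, ← h i A₁ A₂ a₁ a₂, realize_neg, not_not]
  simp only [conjNeg, Realize, key, realize_neg]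
  constructor
  · intro H
    -- `S` collects the pairs whose first member fails; in the remaining pairs the second one must
    -- fail.
    refine ⟨{p | ¬ (ψ₁ p.1 p.2).Realize a₁}, fun p => p.2, fun p hp => ?_⟩
    exact H p.1.1 p.1.2 ⟨not_not.1 p.2, hp⟩
  · rintro ⟨S, hS, hS'⟩ i k ⟨h₁, h₂⟩
    by_cases hp : (⟨i, k⟩ : Σ i, K i) ∈ S
    · exact hS ⟨_, hp⟩ h₁
    · exact hS' ⟨_, hp⟩ h₂

/-! ### The decomposition theorem -/

/-- The placement `σ` must be arbitrary because a quantified variable, last in `φ`, may belong to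
either component, so the variables of the two components become interleaved. -/
theorem IsSigmaR.exists_splitsInto {κ : Cardinal.{u}} (hκ : ℵ₀ ≤ κ) {lam : Ordinal.{u}} {r n : ℕ}
    {φ : InfFormula.{u} (annotated L) n} (hφ : IsSigmaR κ lam r φ) {m₁ m₂ : ℕ}
    (σ : Fin n → Fin m₁ ⊕ Fin m₂) :
    ∃ (K : Type u) (ψ₁ : K → InfFormula.{u} L m₁) (ψ₂ : K → InfFormula.{u} L m₂),
      ReductionSequence.SmallIndex κ lam K ∧
      (∀ k, (∃ s, IsSigmaR (rho κ lam) lam s (ψ₁ k)) ∧ (ψ₁ k).rank ≤ φ.rank) ∧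
      (∀ k, (∃ s, IsSigmaR (rho κ lam) lam s (ψ₂ k)) ∧ (ψ₂ k).rank ≤ φ.rank) ∧
      SplitsInto.{u, w} φ σ ψ₁ ψ₂ := by
  induction lam using WellFoundedLT.induction generalizing r n m₁ m₂ with
  | ind lam ihlam =>
  induction r generalizing n m₁ m₂ with
  | zero =>
    cases hφ with
    | base h =>
      obtain ⟨K, _, ψ₁, ψ₂, h₁, h₂, hs⟩ := h.hasQFSplit.{u, w} σ
      exact ⟨K, ψ₁, ψ₂, .of_finite _ _ _,
        fun k => ⟨⟨0, .base (h₁ k)⟩, (h₁ k).rank_eq_zero.trans_le (zero_le)⟩,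
        fun k => ⟨⟨0, .base (h₂ k)⟩, (h₂ k).rank_eq_zero.trans_le (zero_le)⟩, hs⟩
    | conj hlam ι hι γ lam' r' hlt h =>
      -- The conjuncts are Π̃, so the induction hypothesis is applied to their negations.
      choose K ψ₁ ψ₂ hK h₁ h₂ hs using fun i => ihlam (lam' i) (hlt i) (h i).neg σ
      obtain ⟨hT, hsmall⟩ := ReductionSequence.SmallIndex.sigma hκ hlam hι hlt hK
      have hrank (i : ι) : (γ i).neg.rank ≤ (InfFormula.conj ι γ).rank := by
        rw [rank_neg, rank]
        exact le_iSup (fun i => (γ i).rank) i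
      have hmono (i : ι) : rho κ (lam' i) ≤ rho κ lam := rho_mono κ (hlt i).le
      exact ⟨_, _, _, hsmall,
        fun S => ⟨⟨0, isSigmaR_conjNeg hlam hT (fun p => hlt p.1)
          (fun p => (h₁ p.1 p.2).1.imp fun _ => .mono_card (hmono p.1)) S⟩,
          rank_conjNeg_le fun p => (h₁ p.1 p.2).2.trans (hrank p.1)⟩,
        fun S => ⟨⟨0, isSigmaR_conjNeg hlam hT (fun p => hlt p.1)
          (fun p => (h₂ p.1 p.2).1.imp fun _ => .mono_card (hmono p.1)) Sᶜ⟩,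
          rank_conjNeg_le fun p => (h₂ p.1 p.2).2.trans (hrank p.1)⟩,
        SplitsInto.conj hs⟩
  | succ r ihr =>
    cases hφ with
    | mono h => exact ihr h σ
    | @ex _ _ _ _ φ' h =>
      obtain ⟨K, ψ₁, ψ₂, hK, h₁, h₂, hs⟩ := ihr h
        (Fin.snoc (α := fun _ => Fin (m₁ + 1) ⊕ Fin m₂) (Sum.map Fin.castSucc id ∘ σ)
          (.inl (Fin.last m₁)))
      obtain ⟨K', χ₁, χ₂, hK', h₁', h₂', hs'⟩ := ihr h
        (Fin.snoc (α := fun _ => Fin m₁ ⊕ Fin (m₂ + 1)) (Sum.map id Fin.castSucc ∘ σ)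
          (.inr (Fin.last m₂)))
      rename_i hlam
      refine ⟨K ⊕ K', _, _, hK.sum hK', ?_, ?_, hs.ex hs'⟩
      · rintro (k | k)
        -- Only the member in the component of the witness gains a quantifier, matching the one
        -- gained by `φ`.
        · exact ⟨(h₁ k).1.imp' (· + 1) fun _ => .ex hlam, add_le_add_left (h₁ k).2 1⟩
        · exact ⟨(h₁' k).1, (h₁' k).2.trans le_self_add⟩
      · rintro (k | k)
        · exact ⟨(h₂ k).1, (h₂ k).2.trans le_self_add⟩
        · exact ⟨(h₂' k).1.imp' (· + 1) fun _ => .ex hlam, add_le_add_left (h₂' k).2 1⟩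

end InfFormula

-- From splittings to reduction sequences

namespace ReductionSequence

variable {L : FirstOrder.Language.{a, b}} {m₁ m₂ : ℕ} {K : Type u}

/-- The reduction sequence whose combining formula is `⋁_{k ∈ K} (X_{k, 1} ∧ X_{k, 2})`. -/
def ofDNF (ψ₁ : K → InfFormula.{u} L m₁) (ψ₂ : K → InfFormula.{u} L m₂) :
    ReductionSequence.{u} L m₁ m₂ where
  I := K
  Δ₁ := ψ₁
  Δ₂ := ψ₂
  β := .disj K fun k => .and (.var (.inl k)) (.var (.inr k))

/-- The reduction sequence whose combining formula is `⋀_{k ∈ K} (X_{k, 1} ∨ X_{k, 2})`. -/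
def ofCNF (ψ₁ : K → InfFormula.{u} L m₁) (ψ₂ : K → InfFormula.{u} L m₂) :
    ReductionSequence.{u} L m₁ m₂ where
  I := K
  Δ₁ := ψ₁
  Δ₂ := ψ₂
  β := .conj K fun k => .or (.var (.inl k)) (.var (.inr k))

variable {A₁ A₂ : Type w} [L.Structure A₁] [L.Structure A₂] (a₁ : Fin m₁ → A₁) (a₂ : Fin m₂ → A₂)

open scoped Classical in
-- The assignment is determined by the truth values of the formulas, so its existential quantifier
-- can be dropped.
theorem models_iff_holds (D : ReductionSequence.{u} L m₁ m₂) : D.Models a₁ a₂ ↔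
    D.β.Holds (Sum.elim (fun i => decide ((D.Δ₁ i).Realize a₁))
      fun i => decide ((D.Δ₂ i).Realize a₂)) := by
  constructor
  · rintro ⟨ζ, hζ, h⟩
    convert hζ using 1
    funext i
    rcases i with i | i
    · rw [Bool.eq_iff_iff, (h i).1]
      simp
    · rw [Bool.eq_iff_iff, (h i).2]
      simp
  · exact fun h => ⟨_, h, fun i => by simp⟩

theorem models_ofDNF (ψ₁ : K → InfFormula.{u} L m₁) (ψ₂ : K → InfFormula.{u} L m₂) :
    (ofDNF ψ₁ ψ₂).Models a₁ a₂ ↔ ∃ k, (ψ₁ k).Realize a₁ ∧ (ψ₂ k).Realize a₂ := by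
  rw [models_iff_holds]
  simp only [ofDNF, PropFormula.Holds, PropFormula.and, ULift.forall, Bool.forall_bool, cond_true,
    cond_false, Sum.elim_inl, Sum.elim_inr]
  -- The case `false`, which is the second conjunct, comes first in `Bool.forall_bool`; hence
  -- `and_comm`.
  classical exact exists_congr fun k =>
    and_comm.trans (and_congr decide_eq_true_iff decide_eq_true_iff)

theorem models_ofCNF (ψ₁ : K → InfFormula.{u} L m₁) (ψ₂ : K → InfFormula.{u} L m₂) :
    (ofCNF ψ₁ ψ₂).Models a₁ a₂ ↔ ∀ k, (ψ₁ k).Realize a₁ ∨ (ψ₂ k).Realize a₂ := by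
  rw [models_iff_holds]
  simp only [ofCNF, PropFormula.Holds, PropFormula.or, ULift.exists, Bool.exists_bool, cond_true,
    cond_false, Sum.elim_inl, Sum.elim_inr]
  classical exact forall_congr' fun k =>
    or_comm.trans (or_congr decide_eq_true_iff decide_eq_true_iff)

end ReductionSequence

theorem append_eq_map_comp_finSumFinEquiv_symm {A₁ A₂ : Type w} {m₁ m₂ : ℕ} (a₁ : Fin m₁ → A₁)
    (a₂ : Fin m₂ → A₂) : (Fin.append (Sum.inl ∘ a₁ : Fin m₁ → A₁ ⊕ A₂) (Sum.inr ∘ a₂)) =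
      Sum.map a₁ a₂ ∘ finSumFinEquiv.symm := by
  funext i
  refine Fin.addCases (fun i => ?_) (fun i => ?_) i <;> simp

end TreePrefix

open TreePrefix in
theorem theorem1 (κ μ : Cardinal.{u}) (hκ : ℵ₀ ≤ κ) (lam : Ordinal.{u})
    (L : FirstOrder.Language.{a, b}) [L.IsRelational] [Finite L.Symbols] (m₁ m₂ : ℕ)
    (φ : InfFormula.{u} (annotated L) (m₁ + m₂)) :
    (φ.IsSigma κ lam μ → ∃ D : ReductionSequence.{u} L m₁ m₂,
      D.IsOver (InfFormula.IsSigma (rho κ lam) lam μ) ∧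
      ReductionSequence.IsFVDecomposition.{u, w} D φ ∧ (0 < lam → D.IsDNF κ lam)) ∧
    (φ.IsPi κ lam μ → ∃ D : ReductionSequence.{u} L m₁ m₂,
      D.IsOver (InfFormula.IsPi (rho κ lam) lam μ) ∧
      ReductionSequence.IsFVDecomposition.{u, w} D φ ∧ (0 < lam → D.IsCNF κ lam)) := by
  constructor
  · rintro ⟨⟨r, hr⟩, hμ⟩
    obtain ⟨K, ψ₁, ψ₂, hK, h₁, h₂, hs⟩ := hr.exists_splitsInto.{u, w} hκ finSumFinEquiv.symm
    refine ⟨.ofDNF ψ₁ ψ₂, fun k => ⟨⟨(h₁ k).1, ?_⟩, (h₂ k).1, ?_⟩, fun A₁ A₂ _ _ a₁ a₂ => ?_,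
      fun _ => ⟨K, id, id, hK, rfl⟩⟩
    · exact (Cardinal.ofENat_le_ofENat.2 (h₁ k).2).trans hμ
    · exact (Cardinal.ofENat_le_ofENat.2 (h₂ k).2).trans hμ
    · rw [ReductionSequence.models_ofDNF, append_eq_map_comp_finSumFinEquiv_symm]
      exact hs A₁ A₂ a₁ a₂
  · rintro ⟨⟨r, hr⟩, hμ⟩
    -- Split the Σ̃ formula `¬ φ`; by De Morgan, negating its disjunction of pairs gives the
    -- conjunctive form for `φ`.
    obtain ⟨K, ψ₁, ψ₂, hK, h₁, h₂, hs⟩ := hr.neg.exists_splitsInto.{u, w} hκ finSumFinEquiv.symm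
    simp only [InfFormula.rank_neg] at h₁ h₂
    refine ⟨.ofCNF (fun k => (ψ₁ k).neg) (fun k => (ψ₂ k).neg),
      fun k => ⟨⟨(h₁ k).1.imp fun _ h => h.neg, ?_⟩, (h₂ k).1.imp fun _ h => h.neg, ?_⟩,
      fun A₁ A₂ _ _ a₁ a₂ => ?_, fun _ => ⟨K, id, id, hK, rfl⟩⟩
    · exact (Cardinal.ofENat_le_ofENat.2 ((InfFormula.rank_neg _).trans_le (h₁ k).2)).trans hμ
    · exact (Cardinal.ofENat_le_ofENat.2 ((InfFormula.rank_neg _).trans_le (h₂ k).2)).trans hμ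
    · let := annotatedUnion L A₁ A₂
      rw [ReductionSequence.models_ofCNF, append_eq_map_comp_finSumFinEquiv_symm, ← not_iff_not,
        ← InfFormula.realize_neg]
      refine (hs A₁ A₂ a₁ a₂).trans ?_
      simp [InfFormula.realize_neg, not_or]
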